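/- Let $r\ge 1$ and let $S=\{0,1,\dots,r,\mathrm{dead}\}$ be the set of paths. For $1\le i\le r$ let $\tau_i\colon S\to S$ send $0$ and $i$ to $i$ and every other path to $\mathrm{dead}$. The continuous on-line proper coloring game is played on the cells $(n,m)$, $n\in\mathbb N\cup\{0\}$ (level), $m\in S$ (path). An arrangement $x$ puts an amount $x_{n,m}\ge 0$ of gold sand into each cell $(n,m)$, only finitely many amounts being non-zero. Whenever there is sand in a winning cell, that is, a cell $(0,m)$ with $m\ne\mathrm{dead}$ (in particular at the very beginning), it is at once credited to Pusher and removed from the field; sand on the path $\mathrm{dead}$ is removed from the field without credit. In each round Pusher splits the sand of each cell into a standing part and a running part; then Remover, who sees this, chooses $i\in\{1,\dots,r\}$; the standing sand keeps its cell and the running sand moves from $(n,m)$ to $(n-1,\tau_i(m))$. The game goes on for infinitely many rounds, both players have perfect information, and Pusher's win is the total amount of sand credited to him. For $p=(p_1,\dots,p_r)$ with $p_j\ge 0$ and $p_1+\dots+p_r=1$ define the weights $w(p)_{0,m}=1$ for $m\in\{0,1,\dots,r\}$ and, for $n\ge 1$, $w(p)_{n,0}=p_1^n+\dots+p_r^n$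 and $w(p)_{n,j}=p_j^n$ for $1\le j\le r$; on the path $\mathrm{dead}$ put $w(p)_{n,\mathrm{dead}}=0$ for all $n\ge 0$. Write $x\cdot w(p)=\sum_{n,m}x_{n,m}\,w(p)_{n,m}$. Then for every initial arrangement $x$ the minimum $\min_p x\cdot w(p)$ over the probability simplex is attained, and it is the value of the game to Pusher: it equals the supremum of the wins that Pusher can guarantee against every strategy of Remover, and also the infimum of the bounds to which Remover can hold Pusher's win against every strategy of Pusher. -/

import Mathlib

open scoped NNReal ENNReal

/-- The data of a general chip / gold sand game: a finite set `S` of paths, a death path, and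
a family of mappings `S → S` indexed by `F`, each of which fixes the death path. -/
structure GoldSandGame (S : Type*) [Finite S] (F : Type*) where
  /-- the death path -/
  dead : S
  /-- the mappings among which Remover chooses -/
  τ : F → S → S
  /-- once dead stays dead -/
  τ_dead : ∀ i, τ i dead = dead

namespace GoldSandGame

/-- An arrangement of gold sand: a non-negative amount in each cell `(n, path m)`, only finitely
many amounts being non-zero. -/
abbrev Arrangement (S : Type*) := ℕ × S →₀ ℝ≥0

/-- The record of one round: the sand on the field when the round begins, the running part
chosen by Pusher, and the index of the mapping chosen by Remover. -/
structure Round (S F : Type*) where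
  /-- the sand on the field at the beginning of the round -/
  field : Arrangement S
  /-- the running part -/
  running : Arrangement S
  /-- the index of the mapping picked by Remover -/
  choice : F

/-- A strategy of Pusher: knowing all previous rounds (latest first) and the sand `z` now on the
field, Pusher chooses the running part, which is at most `z` in every cell; the rest stands. -/
abbrev PusherStrategy (S F : Type*) :=
  List (Round S F) → (z : Arrangement S) → {run : Arrangement S // run ≤ z}

/-- A strategy of Remover: knowing all previous rounds (latest first), the sand `z` now on the
field and the running part chosen by Pusher, Remover picks one of the mappings. -/
abbrev RemoverStrategy (S F : Type*) :=
  List (Round S F) → (z : Arrangement S) → {run : Arrangement S // run ≤ z} → F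

variable {S : Type*} [Finite S] {F : Type*} (G : GoldSandGame S F)

/-- The winning cells: level `0` of every path other than the death path. -/
def winningCells : Set (ℕ × S) := {c | c.1 = 0 ∧ c.2 ≠ G.dead}

open Classical in
/-- The total amount of sand in the winning cells. -/
noncomputable def sandInWinningCells (y : Arrangement S) : ℝ≥0 :=
  (y.filter (fun c => c ∈ G.winningCells)).sum fun _ a => a

open Classical in
/-- What is left on the field after the sand of the death path and the sand of the winning cells
have been removed. -/
noncomputable def clear (y : Arrangement S) : Arrangement S :=
  y.filter (fun c => c ∉ G.winningCells ∧ c.2 ≠ G.dead)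

/-- The arrangement arising from `z` when the part `run` runs according to the `i`-th mapping,
`(n, path m) ↦ (n - 1, path (τ i m))`, and the rest `z - run` stands. It is used only for `z` of
the form `G.clear y` and `run ≤ z`, so that no sand runs from level `0`. -/
noncomputable def move (z run : Arrangement S) (i : F) : Arrangement S :=
  (z - run) + run.mapDomain fun c => (c.1 - 1, G.τ i c.2)

/-- The first `n` rounds (latest first) and the arrangement after them (before the sand of the
death path and of the winning cells is removed), if the game starts from `x` and the players
follow the strategies `σ` and `ρ`. -/
noncomputable def play (σ : PusherStrategy S F) (ρ : RemoverStrategy S F) (x : Arrangement S) :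
    ℕ → List (Round S F) × Arrangement S
  | 0 => ([], x)
  | n + 1 =>
    let h := (play σ ρ x n).1
    let z := G.clear (play σ ρ x n).2
    let run := σ h z
    let i := ρ h z run
    (⟨z, run, i⟩ :: h, G.move z run i)

/-- Pusher's win: the total amount of sand that ever reaches the winning cells, including what
lies there in the initial arrangement. -/
noncomputable def pusherWin (σ : PusherStrategy S F) (ρ : RemoverStrategy S F)
    (x : Arrangement S) : ℝ≥0∞ :=
  ∑' n, (G.sandInWinningCells (G.play σ ρ x n).2 : ℝ≥0∞)

/-- The supremum of the wins that Pusher can guarantee. -/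
noncomputable def lowerValue (x : Arrangement S) : ℝ≥0∞ :=
  ⨆ σ : PusherStrategy S F, ⨅ ρ : RemoverStrategy S F, G.pusherWin σ ρ x

/-- The infimum of the bounds to which Remover can hold Pusher's win. -/
noncomputable def upperValue (x : Arrangement S) : ℝ≥0∞ :=
  ⨅ ρ : RemoverStrategy S F, ⨆ σ : PusherStrategy S F, G.pusherWin σ ρ x

/-- The game with initial arrangement `x` has the value `v` to Pusher: the supremum of the wins
that Pusher can guarantee is `v`, and so is the infimum of the bounds that Remover can enforce. -/
def HasValue (x : Arrangement S) (v : ℝ≥0∞) : Prop :=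
  G.lowerValue x = v ∧ G.upperValue x = v

end GoldSandGame

/-- The paths of the game for on-line proper `r`-coloring: `0`, `1, …, r` and `dead`. -/
inductive ProperPath (r : ℕ) : Type
  /-- path `0` -/
  | zero : ProperPath r
  /-- the paths `1, …, r` -/
  | color (j : Fin r) : ProperPath r
  /-- the death path -/
  | dead : ProperPath r

namespace ProperPath

instance (r : ℕ) : Finite (ProperPath r) :=
  Finite.of_surjective
    (fun o : Option (Option (Fin r)) =>
      match o with
      | none => ProperPath.dead
      | some none => ProperPath.zero
      | some (some j) => ProperPath.color j)
    (fun s => by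
      cases s with
      | zero => exact ⟨some none, rfl⟩
      | color j => exact ⟨some (some j), rfl⟩
      | dead => exact ⟨none, rfl⟩)

end ProperPath

/-- The mapping `τ i`: it sends the paths `0` and `i` to `i`, and all other paths to `dead`. -/
def properMap {r : ℕ} (i : Fin r) : ProperPath r → ProperPath r
  | .zero => .color i
  | .color j => if j = i then .color i else .dead
  | .dead => .dead

/-- The gold sand game for on-line proper `r`-coloring. -/
def properColoringGame (r : ℕ) : GoldSandGame (ProperPath r) (Fin r) where
  dead := .dead
  τ := properMap
  τ_dead _ := rfl

/-- The weight vector `w(p)`: `1` on level `0`; on level `i ≥ 1` it is `∑ j, p j ^ i` on path `0`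
and `p j ^ i` on path `j`. Sand on the death path has weight `0`. -/
def properWeight {r : ℕ} (p : Fin r → ℝ) : ℕ × ProperPath r → ℝ
  | (_, .dead) => 0
  | (0, _) => 1
  | (i + 1, .zero) => ∑ j, p j ^ (i + 1)
  | (i + 1, .color j) => p j ^ (i + 1)

/-- The scalar product `x · w` of an arrangement with a vector of weights. -/
noncomputable def sandDot {S : Type*} (x : GoldSandGame.Arrangement S) (w : ℕ × S → ℝ) : ℝ :=
  x.sum fun c a => (a : ℝ) * w c

/-! Remover fixes a minimizing `p`. Picking `i` with probability `p i` would not increase the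
expected `w(p)`-weight of the running sand, so some `i` does not increase it
(`exists_sandDot_step_le`). Credit plus weight on the field then never grows (`upperValue_le`).

Pusher lets the fraction `ε * n` of each cell of level `n` run. To first order in `ε`, if Remover
answers `i`, the new `w(q)`-weight is the old weight at the point moved from `q` by the fraction `ε`
towards vertex `i` (`properWeight_towardVertex_le`). This is again a point of the simplex, so credit
plus minimal weight drops only by the error, at most `r * ε ^ 2 * Q`, where `Q` is the sum of sand
times squared level. Since `Q` shrinks by the factor `1 - ε` each round, the total loss is at most
`r * ε * Q x`, and the weight left on the field tends to `0` (`le_pusherWin_proportionalRun`).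
Finally `ε` is taken small. -/

section SandDot

variable {S : Type*}

open GoldSandGame

/-! ### Linearity and monotonicity of the scalar product -/

theorem sandDot_add (x y : Arrangement S) (w : ℕ × S → ℝ) :
    sandDot (x + y) w = sandDot x w + sandDot y w := by
  classical
  unfold sandDot
  refine Finsupp.sum_add_index' (fun c => by simp) fun c a b => ?_
  push_cast
  ring

theorem sandDot_mono {x : Arrangement S} {w w' : ℕ × S → ℝ}
    (h : ∀ c ∈ x.support, w c ≤ w' c) : sandDot x w ≤ sandDot x w' :=
  Finset.sum_le_sum fun c hc => mul_le_mul_of_nonneg_left (h c hc) (x c).coe_nonneg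

theorem sandDot_nonneg {x : Arrangement S} {w : ℕ × S → ℝ}
    (h : ∀ c, 0 ≤ w c) : 0 ≤ sandDot x w :=
  Finset.sum_nonneg fun c _ => mul_nonneg (x c).coe_nonneg (h c)

theorem sandDot_add_right (x : Arrangement S) (w w' : ℕ × S → ℝ) :
    sandDot x (fun c => w c + w' c) = sandDot x w + sandDot x w' := by
  simp only [sandDot, Finsupp.sum, mul_add, Finset.sum_add_distrib]

theorem sandDot_sub_right (x : Arrangement S) (w w' : ℕ × S → ℝ) :
    sandDot x (fun c => w c - w' c) = sandDot x w - sandDot x w' := by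
  simp only [sandDot, Finsupp.sum, mul_sub, Finset.sum_sub_distrib]

theorem sandDot_mul_right (x : Arrangement S) (a : ℝ) (w : ℕ × S → ℝ) :
    sandDot x (fun c => a * w c) = a * sandDot x w := by
  simp only [sandDot, Finsupp.sum, Finset.mul_sum, mul_left_comm]

theorem sandDot_sum_right {ι : Type*} (s : Finset ι) (x : Arrangement S) (w : ι → ℕ × S → ℝ) :
    sandDot x (fun c => ∑ i ∈ s, w i c) = ∑ i ∈ s, sandDot x (w i) := by
  simp only [sandDot, Finsupp.sum, Finset.mul_sum]
  exact Finset.sum_comm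

theorem sandDot_mapDomain (x : Arrangement S) (f : ℕ × S → ℕ × S) (w : ℕ × S → ℝ) :
    sandDot (x.mapDomain f) w = sandDot x fun c => w (f c) := by
  unfold sandDot
  refine Finsupp.sum_mapDomain_index (fun c => by simp) fun c a b => ?_
  push_cast
  ring

end SandDot

/-! ### One round of a general game, and the proportional run -/

namespace GoldSandGame

variable {S : Type*} [Finite S] {F : Type*} (G : GoldSandGame S F)

theorem sandDot_move {z run : Arrangement S} (h : run ≤ z) (i : F) (w : ℕ × S → ℝ) :
    sandDot (G.move z run i) w =
      sandDot z w - sandDot run w + sandDot run fun c => w (c.1 - 1, G.τ i c.2) := by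
  have hz : sandDot z w = sandDot (z - run) w + sandDot run w := by
    rw [← sandDot_add, tsub_add_cancel_of_le h]
  rw [move, sandDot_add, sandDot_mapDomain, hz]
  ring

theorem fst_ne_zero_of_mem_support_clear {y : Arrangement S} {c : ℕ × S}
    (hc : c ∈ (G.clear y).support) : c.1 ≠ 0 := by
  classical
  rw [clear, Finsupp.support_filter, Finset.mem_filter] at hc
  exact fun h => hc.2.1 ⟨h, hc.2.2⟩

theorem support_clear_subset (y : Arrangement S) : (G.clear y).support ⊆ y.support := by
  classical
  rw [clear, Finsupp.support_filter]
  exact Finset.filter_subset _ _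

theorem sandDot_clear_le (y : Arrangement S) {w : ℕ × S → ℝ} (hw : ∀ c, 0 ≤ w c) :
    sandDot (G.clear y) w ≤ sandDot y w := by
  classical
  have h := Finsupp.filter_add_filter_not y
    (fun c => c ∉ G.winningCells ∧ c.2 ≠ G.dead)
  conv_rhs => rw [← h]
  rw [sandDot_add, clear]
  linarith [sandDot_nonneg (x := y.filter
    fun c => ¬(c ∉ G.winningCells ∧ c.2 ≠ G.dead)) hw]

/-- A weight that is `1` on the winning cells and `0` on the death path is split by clearing the
field into the amount credited and the weight of what is left. -/
theorem sandDot_eq_sandInWinningCells_add (y : Arrangement S) {w : ℕ × S → ℝ}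
    (hwin : ∀ c ∈ G.winningCells, w c = 1) (hdead : ∀ n, w (n, G.dead) = 0) :
    sandDot y w = G.sandInWinningCells y + sandDot (G.clear y) w := by
  classical
  simp only [sandInWinningCells, clear, sandDot, Finsupp.support_filter, Finset.sum_filter, Finsupp.sum]
  push_cast
  rw [← Finset.sum_add_distrib]
  refine Finset.sum_congr rfl fun c _ => ?_
  by_cases h1 : c ∈ G.winningCells
  · simp [h1, hwin c h1]
  · by_cases h2 : c.2 = G.dead
    · have : w c = 0 := by rw [← hdead c.1, ← h2]
      simp [h1, this]
    · simp [h1, h2]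

theorem move_level_le {D : ℕ} {z run : Arrangement S} (h : run ≤ z) (i : F)
    (hz : ∀ c ∈ z.support, c.1 ≤ D) : ∀ c ∈ (G.move z run i).support, c.1 ≤ D := by
  classical
  intro c hc
  rcases Finset.mem_union.1 (Finsupp.support_add hc) with hc | hc
  · refine hz c ?_
    rw [Finsupp.mem_support_iff] at hc ⊢
    exact fun h0 => hc (by simp [h0])
  · obtain ⟨d, hd, rfl⟩ := Finset.mem_image.1 (Finsupp.mapDomain_support hc)
    have : d.1 ≤ D := by
      refine hz d ?_
      rw [Finsupp.mem_support_iff] at hd ⊢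
      exact fun h0 => hd (le_antisymm (h0 ▸ h d) zero_le)
    dsimp only
    omega

/-- The part of `z` that runs when each cell of level `n` releases the fraction
`min 1 (ε * n)` of its sand. -/
noncomputable def proportionalRun (ε : ℝ≥0) (z : Arrangement S) : Arrangement S :=
  Finsupp.onFinset z.support (fun c => min 1 (ε * c.1) * z c) fun _ hc =>
    Finsupp.mem_support_iff.2 (right_ne_zero_of_mul hc)

omit [Finite S] in
theorem proportionalRun_le (ε : ℝ≥0) (z : Arrangement S) : proportionalRun ε z ≤ z := fun _ =>
  mul_le_of_le_one_left zero_le (min_le_left _ _)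

omit [Finite S] in
theorem sandDot_proportionalRun (ε : ℝ≥0) (z : Arrangement S) (w : ℕ × S → ℝ) :
    sandDot (proportionalRun ε z) w = sandDot z fun c => min 1 ((ε : ℝ) * c.1) * w c := by
  unfold sandDot proportionalRun
  rw [Finsupp.onFinset_sum _ (fun _ => by simp)]
  refine Finset.sum_congr rfl fun c _ => ?_
  push_cast
  ring

theorem sandDot_move_proportionalRun {ε : ℝ≥0} {z : Arrangement S}
    (hε : ∀ c ∈ z.support, (ε : ℝ) * c.1 ≤ 1) (i : F) (w : ℕ × S → ℝ) :
    sandDot (G.move z (proportionalRun ε z) i) w =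
      sandDot z fun c => w c - ε * c.1 * w c + ε * c.1 * w (c.1 - 1, G.τ i c.2) := by
  rw [G.sandDot_move (proportionalRun_le ε z), sandDot_proportionalRun, sandDot_proportionalRun,
    ← sandDot_sub_right, ← sandDot_add_right]
  refine Finset.sum_congr rfl fun c hc => ?_
  simp only [min_eq_right (hε c hc)]

theorem play_succ_snd (σ : PusherStrategy S F) (ρ : RemoverStrategy S F) (x : Arrangement S)
    (n : ℕ) : ∃ i, (G.play σ ρ x (n + 1)).2 =
      G.move (G.clear (G.play σ ρ x n).2)
        (σ (G.play σ ρ x n).1 (G.clear (G.play σ ρ x n).2)) i :=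
  ⟨_, rfl⟩

/-- A cell of level `n` loses `ε * n * (n ^ 2 - (n - 1) ^ 2)`, which is at least `ε * n ^ 2`. Paths
play no role. -/
theorem sandDot_sq_move_proportionalRun_le {ε : ℝ≥0} {z : Arrangement S}
    (hε : ∀ c ∈ z.support, (ε : ℝ) * c.1 ≤ 1) (hz : ∀ c ∈ z.support, c.1 ≠ 0) (i : F) :
    sandDot (G.move z (proportionalRun ε z) i) (fun c => (c.1 : ℝ) ^ 2) ≤
      (1 - ε) * sandDot z fun c => (c.1 : ℝ) ^ 2 := by
  rw [G.sandDot_move_proportionalRun hε, ← sandDot_mul_right]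
  refine sandDot_mono fun c hc => ?_
  obtain ⟨n, hn⟩ := Nat.exists_eq_succ_of_ne_zero (hz c hc)
  simp only [hn, Nat.succ_eq_add_one, Nat.add_sub_cancel]
  push_cast
  have h : (0 : ℝ) ≤ ε * (n * (n + 1)) := by positivity
  nlinarith [mul_nonneg h (Nat.cast_nonneg (α := ℝ) n)]

end GoldSandGame

/-- First-order Taylor bound for `h` of either sign; the error stays quadratic because `s` and `s +
h` lie in `[0, 1]`. -/
theorem add_pow_le_pow_add_mul_add_sq {s h : ℝ} (hs0 : 0 ≤ s) (hs1 : s ≤ 1) (h0 : 0 ≤ s + h)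
    (h1 : s + h ≤ 1) (n : ℕ) :
    (s + h) ^ (n + 1) ≤ s ^ (n + 1) + (n + 1) * h * s ^ n + (n + 1) ^ 2 * h ^ 2 := by
  induction n with
  | zero => norm_num; positivity
  | succ n ih =>
    have hsn : s ^ n ≤ 1 := pow_le_one₀ hs0 hs1
    have e1 : (0 : ℝ) ≤ (n + 1) * h ^ 2 * (1 - s ^ n) :=
      mul_nonneg (by positivity) (by linarith)
    have e2 : (0 : ℝ) ≤ (n + 1) ^ 2 * h ^ 2 * (1 - (s + h)) :=
      mul_nonneg (by positivity) (by linarith)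
    have e3 : (0 : ℝ) ≤ (n + 2) * h ^ 2 := by positivity
    have := mul_le_mul_of_nonneg_right ih h0
    push_cast
    rw [pow_succ (s + h)]
    refine this.trans ?_
    have e4 : s ^ (n + 1) = s ^ n * s := pow_succ _ _
    have e5 : s ^ (n + 1 + 1) = s ^ n * s * s := by rw [pow_succ, pow_succ]
    rw [e4, e5]
    linarith

/-! ### The weights of the proper coloring game -/

section ProperColoring

open GoldSandGame

variable {r : ℕ}

theorem properWeight_nonneg {p : Fin r → ℝ} (hp : ∀ j, 0 ≤ p j) (c : ℕ × ProperPath r) :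
    0 ≤ properWeight p c := by
  obtain ⟨n, m⟩ := c
  cases n <;> cases m <;> simp only [properWeight] <;>
    first
      | positivity
      | exact pow_nonneg (hp _) _
      | exact Finset.sum_nonneg fun j _ => pow_nonneg (hp j) _

theorem continuous_properWeight (c : ℕ × ProperPath r) :
    Continuous fun p : Fin r → ℝ => properWeight p c := by
  obtain ⟨n, m⟩ := c
  cases n <;> cases m <;> simp only [properWeight] <;> fun_prop

theorem properWeight_color (p : Fin r → ℝ) (n : ℕ) (j : Fin r) :
    properWeight p (n, .color j) = p j ^ n := by
  cases n <;> simp [properWeight]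

theorem properWeight_zero_succ (p : Fin r → ℝ) (n : ℕ) :
    properWeight p (n + 1, .zero) = ∑ j, p j ^ (n + 1) :=
  rfl

theorem properWeight_dead (p : Fin r → ℝ) (n : ℕ) : properWeight p (n, .dead) = 0 := by
  cases n <;> rfl

theorem properWeight_eq_one_of_mem_winningCells (p : Fin r → ℝ) :
    ∀ c ∈ (properColoringGame r).winningCells, properWeight p c = 1 := by
  rintro ⟨n, m⟩ ⟨hn, hm⟩
  obtain rfl : n = 0 := hn
  cases m
  · rfl
  · rfl
  · exact absurd rfl hm

theorem sandDot_properWeight_eq (p : Fin r → ℝ) (y : Arrangement (ProperPath r)) :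
    sandDot y (properWeight p) = (properColoringGame r).sandInWinningCells y +
      sandDot ((properColoringGame r).clear y) (properWeight p) :=
  (properColoringGame r).sandDot_eq_sandInWinningCells_add y
    (properWeight_eq_one_of_mem_winningCells p) (properWeight_dead p)

/-! ### Remover's strategy -/

/-- If Remover picks `i` with probability `p i`, the expected weight does not increase. -/
theorem sum_mul_properWeight_step_le {p : Fin r → ℝ} (hp : p ∈ stdSimplex ℝ (Fin r))
    (c : ℕ × ProperPath r) :
    ∑ i, p i * properWeight p (c.1 - 1, properMap i c.2) ≤ properWeight p c := by
  have hp1 (j : Fin r) : p j ≤ 1 := hp.2 ▸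
    Finset.single_le_sum (fun i _ => hp.1 i) (Finset.mem_univ j)
  obtain ⟨n, m⟩ := c
  cases m with
  | zero =>
    cases n with
    | zero => simp [properMap, properWeight, hp.2]
    | succ n =>
      simp only [properMap, properWeight_color, properWeight_zero_succ, Nat.add_sub_cancel]
      exact (Finset.sum_congr rfl fun i _ => (pow_succ' (p i) n).symm).le
  | color j =>
    have (i : Fin r) : p i * properWeight p (n - 1, properMap i (.color j)) =
        if j = i then p i * p i ^ (n - 1) else 0 := by
      by_cases h : j = i
      · simp [properMap, h, properWeight_color]
      · simp [properMap, h, properWeight_dead]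
    simp only [this, Finset.sum_ite_eq, Finset.mem_univ, if_true, properWeight_color]
    cases n with
    -- Level `0` stays at level `0` by truncated subtraction, so the claim reads `p j ≤ 1`.
    | zero => simpa using hp1 j
    | succ n => rw [Nat.add_sub_cancel, pow_succ']
  | dead =>
    simp [properMap, properWeight_dead]

theorem exists_sandDot_step_le {p : Fin r → ℝ} (hp : p ∈ stdSimplex ℝ (Fin r))
    (run : Arrangement (ProperPath r)) :
    ∃ i, sandDot run (fun c => properWeight p (c.1 - 1, properMap i c.2)) ≤
      sandDot run (properWeight p) := by
  by_contra! h
  have hle : ∑ i, p i * sandDot run (fun c => properWeight p (c.1 - 1, properMap i c.2)) ≤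
      sandDot run (properWeight p) := by
    simp only [← sandDot_mul_right]
    rw [← sandDot_sum_right]
    exact sandDot_mono fun c _ => sum_mul_properWeight_step_le hp c
  obtain ⟨j, hj⟩ : ∃ j, 0 < p j := by
    by_contra! h0
    have : ∑ j, p j ≤ 0 := Finset.sum_nonpos fun j _ => h0 j
    linarith [hp.2]
  have hlt : ∑ i, p i * sandDot run (properWeight p) <
      ∑ i, p i * sandDot run (fun c => properWeight p (c.1 - 1, properMap i c.2)) :=
    Finset.sum_lt_sum (fun i _ => mul_le_mul_of_nonneg_left (h i).le (hp.1 i))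
      ⟨j, Finset.mem_univ j, mul_lt_mul_of_pos_left (h j) hj⟩
  rw [← Finset.sum_mul, hp.2, one_mul] at hlt
  linarith

theorem upperValue_le {p : Fin r → ℝ} (hp : p ∈ stdSimplex ℝ (Fin r))
    (x : Arrangement (ProperPath r)) :
    (properColoringGame r).upperValue x ≤ ENNReal.ofReal (sandDot x (properWeight p)) := by
  choose f hf using exists_sandDot_step_le hp
  refine iInf_le_of_le (fun _ _ run => f run.1) (iSup_le fun σ => ?_)
  set G := properColoringGame r
  set y := fun n => (G.play σ (fun _ _ run => f run.1) x n).2 with hy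
  -- Invariant: credit so far plus weight on the field is at most the initial weight.
  have key (n : ℕ) : (∑ k ∈ Finset.range n, (G.sandInWinningCells (y k) : ℝ)) +
      sandDot (y n) (properWeight p) ≤ sandDot x (properWeight p) := by
    induction n with
    | zero => simp [hy, play]
    | succ n ih =>
      set run := σ (G.play σ (fun _ _ run => f run.1) x n).1 (G.clear (y n))
      have hmove : y (n + 1) = G.move (G.clear (y n)) run.1 (f run.1) := rfl
      have h1 := sandDot_properWeight_eq p (y n)
      have h2 := G.sandDot_move run.2 (f run.1) (properWeight p)
      have h3 : sandDot run.1 (fun c => properWeight p (c.1 - 1, G.τ (f run.1) c.2)) ≤ _ :=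
        hf run.1
      rw [Finset.sum_range_succ, hmove]
      linarith
  refine ENNReal.tsum_le_of_sum_range_le fun n => ?_
  have hn := key n
  have h0 := sandDot_nonneg (x := y n) (properWeight_nonneg hp.1)
  rw [← ENNReal.ofNNReal_finsetSum, ← ENNReal.ofReal_coe_nnreal]
  refine ENNReal.ofReal_le_ofReal ?_
  push_cast
  linarith

/-! ### Pusher's strategy -/

/-- The point at fraction `ε` of the way from `q` to the `i`-th vertex of the simplex. -/
noncomputable def towardVertex (ε : ℝ) (i : Fin r) (q : Fin r → ℝ) : Fin r → ℝ :=
  (1 - ε) • q + ε • Pi.single i 1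

theorem towardVertex_mem {ε : ℝ} (h0 : 0 ≤ ε) (h1 : ε ≤ 1) (i : Fin r) {q : Fin r → ℝ}
    (hq : q ∈ stdSimplex ℝ (Fin r)) : towardVertex ε i q ∈ stdSimplex ℝ (Fin r) :=
  convex_stdSimplex ℝ (Fin r) hq (single_mem_stdSimplex ℝ i) (by linarith) h0 (by ring)

theorem towardVertex_pow_le {ε : ℝ} (h0 : 0 ≤ ε) (h1 : ε ≤ 1) (i : Fin r) {q : Fin r → ℝ}
    (hq : q ∈ stdSimplex ℝ (Fin r)) (j : Fin r) (n : ℕ) :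
    towardVertex ε i q j ^ (n + 1) ≤ q j ^ (n + 1) - ε * (n + 1) * q j ^ (n + 1) +
      (if j = i then ε * (n + 1) * q j ^ n else 0) + ε ^ 2 * (n + 1) ^ 2 := by
  have le_one {p : Fin r → ℝ} (hp : p ∈ stdSimplex ℝ (Fin r)) : p j ≤ 1 := hp.2 ▸
    Finset.single_le_sum (fun i _ => hp.1 i) (Finset.mem_univ j)
  have hq' := towardVertex_mem h0 h1 i hq
  have hqj0 := hq.1 j
  have hqj1 := le_one hq
  -- `h` is coordinate `j` of vertex `i` minus `q`, hence in `[-1, 1]`.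
  obtain ⟨h, hh, hsq⟩ : ∃ h, towardVertex ε i q j = q j + ε * h ∧ h ^ 2 ≤ 1 ∧
      h = (if j = i then 1 else 0) - q j := by
    refine ⟨_, ?_, ?_, rfl⟩
    · simp only [towardVertex, Pi.add_apply, Pi.smul_apply, smul_eq_mul, Pi.single_apply]
      ring
    · split_ifs <;> nlinarith
  have hb := add_pow_le_pow_add_mul_add_sq (h := ε * h) hqj0 hqj1 (hh ▸ hq'.1 j)
    (hh ▸ le_one hq') n
  rw [hh]
  have hsq' : ((n : ℝ) + 1) ^ 2 * (ε * h) ^ 2 ≤ ε ^ 2 * (n + 1) ^ 2 := by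
    have : 0 ≤ ((n : ℝ) + 1) ^ 2 * ε ^ 2 * (1 - h ^ 2) :=
      mul_nonneg (by positivity) (by linarith [hsq.1])
    linarith
  refine hb.trans ?_
  have : ((n : ℝ) + 1) * (ε * h) * q j ^ n =
      -(ε * (n + 1) * q j ^ (n + 1)) + if j = i then ε * (n + 1) * q j ^ n else 0 := by
    rw [hsq.2]
    split_ifs <;> ring
  linarith

/-- Apart from the error, the right side is what a cell contributes after a proportional run
answered by `i`. The factor `r` comes from path `0`, which sums `r` powers. -/
theorem properWeight_towardVertex_le {ε : ℝ} (h0 : 0 ≤ ε) (h1 : ε ≤ 1) (hr : 1 ≤ r) (i : Fin r)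
    {q : Fin r → ℝ} (hq : q ∈ stdSimplex ℝ (Fin r)) {c : ℕ × ProperPath r} (hc : c.1 ≠ 0) :
    properWeight (towardVertex ε i q) c ≤ properWeight q c - ε * c.1 * properWeight q c +
      ε * c.1 * properWeight q (c.1 - 1, properMap i c.2) + r * ε ^ 2 * (c.1 : ℝ) ^ 2 := by
  obtain ⟨n, m⟩ := c
  obtain ⟨n, rfl⟩ := Nat.exists_eq_succ_of_ne_zero hc
  have key := fun j => towardVertex_pow_le h0 h1 i hq j n
  simp only [Nat.succ_eq_add_one, Nat.add_sub_cancel]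
  push_cast
  have hr' : (1 : ℝ) ≤ r := by exact_mod_cast hr
  cases m with
  | zero =>
    simp only [properMap, properWeight_color, properWeight_zero_succ]
    refine (Finset.sum_le_sum fun j _ => key j).trans (le_of_eq ?_)
    simp only [Finset.sum_add_distrib, Finset.sum_sub_distrib, ← Finset.mul_sum,
      Finset.sum_ite_eq', Finset.mem_univ, if_true, Finset.sum_const, Finset.card_univ,
      Fintype.card_fin, nsmul_eq_mul]
    ring
  | color j =>
    have hle : ε ^ 2 * ((n : ℝ) + 1) ^ 2 ≤ r * ε ^ 2 * (n + 1) ^ 2 := by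
      have : 0 ≤ ((r : ℝ) - 1) * (ε ^ 2 * ((n : ℝ) + 1) ^ 2) :=
        mul_nonneg (by linarith) (by positivity)
      linarith
    have := key j
    by_cases hji : j = i
    · subst hji
      simp only [properMap, properWeight_color, if_true] at this ⊢
      linarith
    · simp only [properMap, properWeight_color, hji, if_false,
        properWeight_dead] at this ⊢
      linarith
  | dead =>
    simp only [properMap, properWeight_dead]
    have : (0 : ℝ) ≤ r * ε ^ 2 * (n + 1) ^ 2 := by positivity
    linarith

theorem properWeight_le_sq (hr : 1 ≤ r) {q : Fin r → ℝ} (hq : q ∈ stdSimplex ℝ (Fin r))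
    {c : ℕ × ProperPath r} (hc : c.1 ≠ 0) : properWeight q c ≤ r * (c.1 : ℝ) ^ 2 := by
  obtain ⟨n, m⟩ := c
  obtain ⟨n, rfl⟩ := Nat.exists_eq_succ_of_ne_zero hc
  have hr' : (1 : ℝ) ≤ r := by exact_mod_cast hr
  have hpow (j : Fin r) : q j ^ (n + 1) ≤ 1 := pow_le_one₀ (hq.1 j)
    (hq.2 ▸ Finset.single_le_sum (fun i _ => hq.1 i) (Finset.mem_univ j))
  have hn : (1 : ℝ) ≤ ((n + 1 : ℕ) : ℝ) ^ 2 :=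
    one_le_pow₀ (by push_cast; linarith [n.cast_nonneg (α := ℝ)])
  have hle : (r : ℝ) ≤ r * ((n + 1 : ℕ) : ℝ) ^ 2 := le_mul_of_one_le_right (by linarith) hn
  cases m with
  | zero =>
    refine le_trans ?_ hle
    simpa [properWeight] using Finset.sum_le_sum fun j (_ : j ∈ Finset.univ) => hpow j
  | color j => exact (hpow j).trans (hr'.trans hle)
  | dead => exact le_trans (by simp [properWeight]) hle

/-- By letting each cell of level `n` release the fraction `ε * n` of its sand in every round,
Pusher wins all but an amount of order `ε` of the minimal weight. -/
theorem le_pusherWin_proportionalRun (hr : 1 ≤ r) {x : Arrangement (ProperPath r)} {ε : ℝ≥0}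
    (hε0 : 0 < ε) (hε1 : ε ≤ 1) (hε : ∀ c ∈ x.support, (ε : ℝ) * c.1 ≤ 1) {v : ℝ}
    (hv : ∀ q ∈ stdSimplex ℝ (Fin r), v ≤ sandDot x (properWeight q))
    (ρ : RemoverStrategy (ProperPath r) (Fin r)) :
    ENNReal.ofReal (v - r * ε * sandDot x fun c => (c.1 : ℝ) ^ 2) ≤
      (properColoringGame r).pusherWin
        (fun _ z => ⟨proportionalRun ε z, proportionalRun_le ε z⟩) ρ x := by
  set G := properColoringGame r
  set σ : PusherStrategy (ProperPath r) (Fin r) :=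
    fun _ z => ⟨proportionalRun ε z, proportionalRun_le ε z⟩
  set y := fun n => (G.play σ ρ x n).2 with hy
  set Q : Arrangement (ProperPath r) → ℝ := fun z => sandDot z fun c => (c.1 : ℝ) ^ 2 with hQ
  have hε1' : (ε : ℝ) ≤ 1 := by exact_mod_cast hε1
  have hε0' : (0 : ℝ) < ε := by exact_mod_cast hε0
  have hQ0 (z : Arrangement (ProperPath r)) : 0 ≤ Q z := sandDot_nonneg fun c => by positivity
  have hmove (n : ℕ) : ∃ i, y (n + 1) =
      G.move (G.clear (y n)) (proportionalRun ε (G.clear (y n))) i :=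
    G.play_succ_snd σ ρ x n
  -- Levels never rise, so the cap `min 1` never takes effect.
  have hlevel (n : ℕ) : ∀ c ∈ (y n).support, (ε : ℝ) * c.1 ≤ 1 := by
    have hfloor (k : ℕ) : (ε : ℝ) * k ≤ 1 ↔ k ≤ ⌊(ε : ℝ)⁻¹⌋₊ := by
      rw [Nat.le_floor_iff (by positivity), ← one_div, le_div_iff₀ hε0', mul_comm]
    simp only [hfloor] at hε ⊢
    induction n with
    | zero => exact hε
    | succ n ih =>
      obtain ⟨i, hi⟩ := hmove n
      rw [hi]
      exact G.move_level_le (proportionalRun_le _ _) i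
        fun c hc => ih c (G.support_clear_subset _ hc)
  have hlevel' (n : ℕ) : ∀ c ∈ (G.clear (y n)).support, (ε : ℝ) * c.1 ≤ 1 :=
    fun c hc => hlevel n c (G.support_clear_subset _ hc)
  have hclear (n : ℕ) : Q (G.clear (y n)) ≤ Q (y n) :=
    G.sandDot_clear_le _ fun c => by positivity
  have hstep (n : ℕ) : Q (y (n + 1)) ≤ (1 - ε) * Q (G.clear (y n)) := by
    obtain ⟨i, hi⟩ := hmove n
    rw [hi]
    exact G.sandDot_sq_move_proportionalRun_le (hlevel' n)
      (fun c hc => G.fst_ne_zero_of_mem_support_clear hc) i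
  have hdecay (n : ℕ) : Q (y n) ≤ (1 - ε) ^ n * Q x := by
    induction n with
    | zero => simp [hy, play]
    | succ n ih =>
      rw [pow_succ', mul_assoc]
      exact (hstep n).trans (mul_le_mul_of_nonneg_left ((hclear n).trans ih) (by linarith))
  -- The term `r * ε * Q` pays in advance for all later errors. The claim is for all `q` because the
  -- step applies it at a moved point.
  have hpot (n : ℕ) : ∀ q ∈ stdSimplex ℝ (Fin r), v - r * ε * Q x ≤
      (∑ k ∈ Finset.range n, (G.sandInWinningCells (y k) : ℝ)) +
        sandDot (y n) (properWeight q) - r * ε * Q (y n) := by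
    induction n with
    | zero =>
      intro q hq
      simp only [hy, play, Finset.range_zero, Finset.sum_empty]
      linarith [hv q hq]
    | succ n ih =>
      intro q hq
      obtain ⟨i, hi⟩ := hmove n
      have h1 := ih _ (towardVertex_mem hε0'.le hε1' i hq)
      rw [sandDot_properWeight_eq] at h1
      have h2 : sandDot (G.clear (y n)) (properWeight (towardVertex ε i q)) ≤
          sandDot (y (n + 1)) (properWeight q) + r * ε ^ 2 * Q (G.clear (y n)) := by
        rw [hi, G.sandDot_move_proportionalRun (hlevel' n), ← sandDot_mul_right,
          ← sandDot_add_right]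
        exact sandDot_mono fun c hc => properWeight_towardVertex_le hε0'.le hε1' hr i hq
          (G.fst_ne_zero_of_mem_support_clear hc)
      have h3 : (r : ℝ) * ε * (Q (y (n + 1)) + ε * Q (G.clear (y n))) ≤ r * ε * Q (y n) :=
        mul_le_mul_of_nonneg_left (by linarith [hstep n, hclear n]) (by positivity)
      rw [Finset.sum_range_succ]
      linarith
  by_cases htop : G.pusherWin σ ρ x = ⊤
  · rw [htop]
    exact le_top
  rw [ENNReal.ofReal_le_iff_le_toReal htop]
  obtain ⟨q, hq⟩ : ∃ q, q ∈ stdSimplex ℝ (Fin r) := ⟨_, single_mem_stdSimplex ℝ ⟨0, hr⟩⟩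
  -- Whatever is still uncredited after `n` rounds weighs at most `r * Q`, which decays
  -- geometrically.
  have hbound (n : ℕ) : v - r * ε * Q x - r * ((1 - ε) ^ n * Q x) ≤
      (G.pusherWin σ ρ x).toReal := by
    have h1 := hpot n q hq
    rw [sandDot_properWeight_eq] at h1
    have h2 : sandDot (G.clear (y n)) (properWeight q) ≤ r * Q (G.clear (y n)) := by
      rw [← sandDot_mul_right]
      exact sandDot_mono fun c hc =>
        properWeight_le_sq hr hq (G.fst_ne_zero_of_mem_support_clear hc)
    have h3 : (r : ℝ) * Q (G.clear (y n)) ≤ r * ((1 - ε) ^ n * Q x) :=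
      mul_le_mul_of_nonneg_left ((hclear n).trans (hdecay n)) (by positivity)
    have h4 : (0 : ℝ) ≤ r * ε * Q (y n) := mul_nonneg (by positivity) (hQ0 _)
    have h5 : (∑ k ∈ Finset.range (n + 1), (G.sandInWinningCells (y k) : ℝ)) ≤
        (G.pusherWin σ ρ x).toReal := by
      have := ENNReal.toReal_mono htop (ENNReal.sum_le_tsum
        (f := fun n => (G.sandInWinningCells (y n) : ℝ≥0∞)) (Finset.range (n + 1)))
      rw [← ENNReal.ofNNReal_finsetSum, ENNReal.coe_toReal] at this
      push_cast at this
      exact this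
    rw [Finset.sum_range_succ] at h5
    linarith
  have hlim : Filter.Tendsto (fun n : ℕ => v - r * ε * Q x - r * ((1 - (ε : ℝ)) ^ n * Q x))
      Filter.atTop (nhds (v - r * ε * Q x - r * (0 * Q x))) :=
    (((tendsto_pow_atTop_nhds_zero_of_lt_one (by linarith) (by linarith)).mul_const _).const_mul
      _).const_sub _
  simpa using le_of_tendsto' hlim hbound

theorem le_lowerValue (hr : 1 ≤ r) {x : Arrangement (ProperPath r)} {v : ℝ}
    (hv : ∀ q ∈ stdSimplex ℝ (Fin r), v ≤ sandDot x (properWeight q)) :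
    ENNReal.ofReal v ≤ (properColoringGame r).lowerValue x := by
  refine ENNReal.le_of_forall_pos_le_add fun δ hδ _ => ?_
  set Q : ℝ := sandDot x fun c => (c.1 : ℝ) ^ 2
  have hQ : 0 ≤ Q := sandDot_nonneg fun c => by positivity
  set D : ℕ := x.support.sup Prod.fst
  -- One equation yields `ε ≤ 1`, `ε * D ≤ 1` and `r * ε * Q ≤ δ`, its summands being non-negative.
  obtain ⟨ε, hε0, hε⟩ : ∃ ε : ℝ≥0, 0 < ε ∧ ε * (1 + D + r * Q / δ) = (1 : ℝ) := by
    have h : 0 < 1 + D + r * Q / δ := by positivity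
    exact ⟨⟨(1 + D + r * Q / δ)⁻¹, by positivity⟩, inv_pos.2 h, inv_mul_cancel₀ h.ne'⟩
  have h1 : (0 : ℝ) ≤ ε * D := by positivity
  have h2 : (0 : ℝ) ≤ ε * (r * Q / δ) := by positivity
  have h3 : (0 : ℝ) < ε := hε0
  have hδ' : (0 : ℝ) < δ := hδ
  have hloss : r * ε * Q ≤ δ := by
    have : ε * (r * Q / δ) ≤ 1 := by linarith
    rw [← mul_div_assoc, div_le_one hδ'] at this
    linarith
  have hle : ENNReal.ofReal (v - r * ε * Q) ≤ (properColoringGame r).lowerValue x := by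
    refine le_iSup_of_le _ (le_iInf fun ρ => le_pusherWin_proportionalRun hr hε0
      (by exact_mod_cast (by linarith : (ε : ℝ) ≤ 1)) (fun c hc => ?_) hv ρ)
    have hc' : (c.1 : ℝ) ≤ D := by exact_mod_cast Finset.le_sup (f := Prod.fst) hc
    have := mul_le_mul_of_nonneg_left hc' h3.le
    linarith
  calc ENNReal.ofReal v ≤ ENNReal.ofReal ((v - r * ε * Q) + δ) :=
        ENNReal.ofReal_le_ofReal (by linarith)
    _ ≤ ENNReal.ofReal (v - r * ε * Q) + ENNReal.ofReal δ := ENNReal.ofReal_add_le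
    _ ≤ _ := by
        rw [ENNReal.ofReal_coe_nnreal]
        gcongr

end ProperColoring

/-! ### Both bounds at a minimizing point -/

theorem proposition2 (r : ℕ) (hr : 1 ≤ r)
    (x : GoldSandGame.Arrangement (ProperPath r)) :
    ∃ v : ℝ≥0,
      IsLeast ((fun p : Fin r → ℝ => sandDot x (properWeight p)) '' stdSimplex ℝ (Fin r)) (v : ℝ) ∧
      (properColoringGame r).HasValue x (v : ℝ≥0∞) := by
  have hcont : Continuous fun p : Fin r → ℝ => sandDot x (properWeight p) :=
    continuous_finsetSum _ fun c _ => (continuous_properWeight c).const_mul _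
  obtain ⟨p, hp, hmin⟩ := (isCompact_stdSimplex ℝ (Fin r)).exists_isMinOn
    ⟨_, single_mem_stdSimplex ℝ ⟨0, hr⟩⟩ hcont.continuousOn
  have hmin' : ∀ q ∈ stdSimplex ℝ (Fin r),
      sandDot x (properWeight p) ≤ sandDot x (properWeight q) := fun q hq => hmin hq
  have h0 : 0 ≤ sandDot x (properWeight p) := sandDot_nonneg (properWeight_nonneg hp.1)
  refine ⟨⟨_, h0⟩, ⟨⟨p, hp, rfl⟩, ?_⟩, ?_⟩
  · rintro _ ⟨q, hq, rfl⟩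
    exact hmin' q hq
  · have hlow := le_lowerValue hr hmin'
    have hup := upperValue_le hp x
    have hle : (properColoringGame r).lowerValue x ≤ (properColoringGame r).upperValue x :=
      iSup_iInf_le_iInf_iSup _
    rw [ENNReal.ofReal_eq_coe_nnreal h0] at hlow hup
    exact ⟨le_antisymm (hle.trans hup) hlow, le_antisymm hup (hlow.trans hle)⟩
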